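/- Let $(\Omega,\mathcal F,\mathbb P)$ be a complete probability space carrying a standard $n$-dimensional Brownian motion $W=(W_s)_{s\ge0}$. Let $\mathbb F=(\mathcal F_s)_{s\ge 0}$ be the right-continuous $\mathbb P$-completion of the natural filtration of $W$, and for $t\ge0$ let $\mathbb F_t=(\mathcal F_{t,s})_{s\ge0}$, where $\mathcal F_{t,s}$ is the $\mathbb P$-completion of $\sigma(W_r-W_t:\ t\le r\le t\vee s)$. Let $\mathbb U\subset\mathbb R^m$ be compact, and let $f:\mathbb R^n\times\mathbb U\to\mathbb R^n$ and $\sigma:\mathbb R^n\times\mathbb U\to\mathbb R^{n\times n}$ be continuous, and Lipschitz in the first argument uniformly in the second. Let $A,B\subset\mathbb R^n$ be disjoint closed sets and let $T\ge0$. Fix $(t,x)\in[0,T]\times\mathbb R^n$ and an information filtration $\mathbb G\in\{\mathbb F,\mathbb F_t\}$. Let $\mathcal U^{\mathbb G}$ be the set of $\mathbb G$-progressively measurable $\mathbb U$-valued processes. For $u\in\mathcal U^{\mathbb G}$ let $X=X^{t,x;u}$ be the continuous $\mathbb G$-adapted strong solution of $$\mathrm dX_s=f(X_s,u_s)\,\mathrm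 ds+\sigma(X_s,u_s)\,\mathrm dW_s,\quad s\ge t,\qquad X_s=x\ \text{ for } s\le t .$$ For a $[t,\infty]$-valued (a.s.) random time $\tau$ let $\mathcal T^{\mathbb G}_{[t,\tau]}$ be the set of $\mathbb G$-stopping times $\rho$ with $t\le\rho\le\tau$ almost surely. Put $\tau_{A\cup B}=\inf\{s\ge t: X_s\in A\cup B\}$ (with $\inf\emptyset=\infty$), $\bar\tau=\tau_{A\cup B}\wedge T$, and $$V_1^{\mathbb G}(t,x)=\sup_{u\in\mathcal U^{\mathbb G}}\mathbb E\bigl[\mathbf 1_A(X_{\bar\tau})\bigr],$$ $$V_2^{\mathbb G}(t,x)=\sup_{u\in\mathcal U^{\mathbb G}}\mathbb E\Bigl[\sup_{s\in[t,T]}\bigl\{\mathbf 1_A(X_s)\wedge\inf_{r\in[t,s]}\mathbf 1_{B^c}(X_r)\bigr\}\Bigr],$$ $$V_3^{\mathbb G}(t,x)=\sup_{u\in\mathcal U^{\mathbb G}}\ \sup_{\tau\in\mathcal T^{\mathbb G}_{[t,T]}}\ \inf_{\rho\in\mathcal T^{\mathbb G}_{[t,\tau]}}\mathbb E\bigl[\mathbf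 1_A(X_\tau)\wedge\mathbf 1_{B^c}(X_\rho)\bigr].$$ Then $V_1^{\mathbb G}(t,x)=V_2^{\mathbb G}(t,x)=V_3^{\mathbb G}(t,x)$ for every $(t,x)\in[0,T]\times\mathbb R^n$, both for $\mathbb G=\mathbb F$ and for $\mathbb G=\mathbb F_t$. -/

import Mathlib

open MeasureTheory ProbabilityTheory Set Filter Topology
open scoped NNReal ENNReal

noncomputable section

namespace ReachAvoid

section Noise

variable {Ω : Type*} {mΩ : MeasurableSpace Ω} {n : ℕ}

/-- `W` is a standard `n`-dimensional Brownian motion: its coordinates are independent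
real Brownian motions (started at `0`, with almost surely continuous paths). -/
structure IsBrownianMotion (W : ℝ≥0 → Ω → EuclideanSpace ℝ (Fin n)) (P : Measure Ω) : Prop where
  isBrownianReal : ∀ i, IsBrownianReal (fun s ω => W s ω i) P
  indep : iIndepFun (fun (i : Fin n) (ω : Ω) (s : ℝ≥0) => W s ω i) P

/-- The `P`-completion of a filtration: every `𝔽 s` is replaced by the σ-algebra of all sets that
differ from a set of `𝔽 s` by a `P`-null set. -/
def completion (P : Measure Ω) [P.IsComplete] (𝔽 : Filtration ℝ≥0 mΩ) : Filtration ℝ≥0 mΩ where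
  seq s := eventuallyMeasurableSpace (𝔽 s) (ae P)
  mono' _ _ hrs := fun _ ⟨E', hE', h⟩ => ⟨E', 𝔽.mono hrs _ hE', h⟩
  le' s := by
    rintro E ⟨E', hE', h⟩
    exact (NullMeasurableSet.congr (𝔽.le s E' hE').nullMeasurableSet h.symm).measurable_of_complete

/-- The filtration `𝔽`: the right-continuous completion of the natural filtration of `W`. -/
def brownianFiltration (P : Measure Ω) [P.IsComplete]
    (W : ℝ≥0 → Ω → EuclideanSpace ℝ (Fin n)) (hW : ∀ s, Measurable (W s)) :
    Filtration ℝ≥0 mΩ :=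
  (completion P (Filtration.natural W fun s => (hW s).stronglyMeasurable)).rightCont

/-- The (uncompleted) filtration `s ↦ σ(W_r - W_t, t ≤ r ≤ t ∨ s)`. -/
def incrementFiltration (W : ℝ≥0 → Ω → EuclideanSpace ℝ (Fin n)) (hW : ∀ s, Measurable (W s))
    (t : ℝ≥0) : Filtration ℝ≥0 mΩ where
  seq s := ⨆ r ∈ Icc t (t ⊔ s), MeasurableSpace.comap (fun ω => W r ω - W t ω) inferInstance
  mono' _ _ h := biSup_mono fun _ hr => ⟨hr.1, hr.2.trans (sup_le_sup_left h t)⟩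
  le' _ := iSup₂_le fun r _ => ((hW r).sub (hW t)).comap_le

/-- The auxiliary filtration `𝔽_t`: `𝓕_{t,s}` is the `P`-completion of
`σ(W_r - W_t, t ≤ r ≤ t ∨ s)`. -/
def shiftedFiltration (P : Measure Ω) [P.IsComplete]
    (W : ℝ≥0 → Ω → EuclideanSpace ℝ (Fin n)) (hW : ∀ s, Measurable (W s)) (t : ℝ≥0) :
    Filtration ℝ≥0 mΩ :=
  completion P (incrementFiltration W hW t)

end Noise

section Ito

variable {Ω : Type*} {mΩ : MeasurableSpace Ω} {n : ℕ}

/-- The squared Frobenius norm of a matrix. -/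
def frobSq (M : Matrix (Fin n) (Fin n) ℝ) : ℝ := ∑ i, ∑ j, M i j ^ 2

/-- Matrix-valued simple integrands `∑_{i < N} ξ_i 1_{(t_i, t_{i+1}]}` with `t_0 ≤ t_1 ≤ ...` and
bounded, `𝔽 t_i`-measurable `ξ_i`. -/
structure SimpleIntegrand (𝔽 : Filtration ℝ≥0 mΩ) (n : ℕ) where
  /-- number of steps -/
  N : ℕ
  /-- partition points -/
  time : ℕ → ℝ≥0
  mono : Monotone time
  /-- values -/
  coeff : ℕ → Ω → Matrix (Fin n) (Fin n) ℝ
  measurable : ∀ i a b, Measurable[𝔽 (time i)] fun ω => coeff i ω a b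
  bounded : ∃ C : ℝ, ∀ i ω a b, |coeff i ω a b| ≤ C

/-- The process defined by a simple integrand. -/
def SimpleIntegrand.eval {𝔽 : Filtration ℝ≥0 mΩ} (S : SimpleIntegrand 𝔽 n) (r : ℝ≥0) (ω : Ω) :
    Matrix (Fin n) (Fin n) ℝ :=
  ∑ i ∈ Finset.range S.N, if S.time i < r ∧ r ≤ S.time (i + 1) then S.coeff i ω else 0

/-- The integral `∫_t^s S dW` of a simple integrand; `max t (min s r)` is the projection of `r`
onto `[t, s]`. -/
def SimpleIntegrand.integral {𝔽 : Filtration ℝ≥0 mΩ} (S : SimpleIntegrand 𝔽 n)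
    (W : ℝ≥0 → Ω → EuclideanSpace ℝ (Fin n)) (t s : ℝ≥0) (ω : Ω) : EuclideanSpace ℝ (Fin n) :=
  ∑ i ∈ Finset.range S.N, (S.coeff i ω).toEuclideanLin
    (W (max t (min s (S.time (i + 1)))) ω - W (max t (min s (S.time i))) ω)

/-- `Y` is (a version of) the Itô integral `∫_t^s H_r dW_r`: there are simple integrands `S_k` with
`∫_t^s |S_k - H|² dr → 0` and `∫_t^s S_k dW → Y` in probability. -/
def IsItoIntegral (P : Measure Ω) (𝔽 : Filtration ℝ≥0 mΩ)
    (W : ℝ≥0 → Ω → EuclideanSpace ℝ (Fin n)) (H : ℝ≥0 → Ω → Matrix (Fin n) (Fin n) ℝ)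
    (t s : ℝ≥0) (Y : Ω → EuclideanSpace ℝ (Fin n)) : Prop :=
  ∃ S : ℕ → SimpleIntegrand 𝔽 n,
    (∀ ε : ℝ≥0∞, 0 < ε → Tendsto (fun k => P {ω | ε ≤ ∫⁻ r in Ioc (t : ℝ) (s : ℝ),
      ENNReal.ofReal (frobSq ((S k).eval r.toNNReal ω - H r.toNNReal ω))}) atTop (𝓝 0)) ∧
    TendstoInMeasure P (fun k ω => (S k).integral W t s ω) atTop Y

end Ito

section Control

variable {Ω : Type*} {mΩ : MeasurableSpace Ω} {n m : ℕ} {U : Set (EuclideanSpace ℝ (Fin m))}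

/-- `(u, X)` is an admissible pair with initial condition `(t, x)` relative to the information
filtration `𝔾`: `u` is a `𝔾`-progressively measurable `U`-valued control and `X = X^{t,x;u}` is a
strong solution of `dX_s = f(X_s, u_s) ds + σ(X_s, u_s) dW_s` on `[t, ∞)` with `X_t = x`, extended
by `X_s = x` for `s ≤ t`: a continuous `𝔾`-adapted process that satisfies the integral equation.
Itô integrals are taken with respect to the Brownian filtration `𝔽`. -/
structure IsAdmissiblePair (P : Measure Ω) (𝔽 𝔾 : Filtration ℝ≥0 mΩ)
    (W : ℝ≥0 → Ω → EuclideanSpace ℝ (Fin n))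
    (f : EuclideanSpace ℝ (Fin n) → U → EuclideanSpace ℝ (Fin n))
    (σ : EuclideanSpace ℝ (Fin n) → U → Matrix (Fin n) (Fin n) ℝ)
    (t : ℝ≥0) (x : EuclideanSpace ℝ (Fin n))
    (u : ℝ≥0 → Ω → U) (X : ℝ≥0 → Ω → EuclideanSpace ℝ (Fin n)) : Prop where
  progressive : IsProgressive 𝔾 u
  adapted : Adapted 𝔾 X
  continuous : ∀ ω, Continuous fun s => X s ω
  initial : ∀ s ≤ t, ∀ ω, X s ω = x
  sde : ∀ s, t ≤ s → IsItoIntegral P 𝔽 W (fun r ω => σ (X r ω) (u r ω)) t s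
    (fun ω => X s ω - x -
      ∫ r in (t : ℝ)..(s : ℝ), f (X r.toNNReal ω) (u r.toNNReal ω))

/-- The type of admissible pairs. -/
abbrev AdmissiblePair (P : Measure Ω) (𝔽 𝔾 : Filtration ℝ≥0 mΩ)
    (W : ℝ≥0 → Ω → EuclideanSpace ℝ (Fin n))
    (f : EuclideanSpace ℝ (Fin n) → U → EuclideanSpace ℝ (Fin n))
    (σ : EuclideanSpace ℝ (Fin n) → U → Matrix (Fin n) (Fin n) ℝ)
    (t : ℝ≥0) (x : EuclideanSpace ℝ (Fin n)) : Type _ :=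
  {p : (ℝ≥0 → Ω → U) × (ℝ≥0 → Ω → EuclideanSpace ℝ (Fin n)) //
    IsAdmissiblePair P 𝔽 𝔾 W f σ t x p.1 p.2}

/-- The set of all `𝔾`-stopping times `σ` with `t ≤ σ ≤ τ` almost surely. -/
def stoppingTimes (P : Measure Ω) (𝔾 : Filtration ℝ≥0 mΩ) (t : ℝ≥0) (τ : Ω → WithTop ℝ≥0) :
    Set (Ω → WithTop ℝ≥0) :=
  {σ | IsStoppingTime 𝔾 σ ∧ ∀ᵐ ω ∂P, (t : WithTop ℝ≥0) ≤ σ ω ∧ σ ω ≤ τ ω}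

/-- The indicator function `1_A`. -/
def ind (A : Set (EuclideanSpace ℝ (Fin n))) : EuclideanSpace ℝ (Fin n) → ℝ :=
  A.indicator fun _ => 1

/-- `τ̄ = τ_{A ∪ B} ∧ T`, where `τ_S = inf {s ≥ t | X_s ∈ S}` is the first entry time to `S`. -/
def exitTime (A B : Set (EuclideanSpace ℝ (Fin n))) (T t : ℝ≥0)
    (X : ℝ≥0 → Ω → EuclideanSpace ℝ (Fin n)) (ω : Ω) : WithTop ℝ≥0 :=
  min (hittingAfter X (A ∪ B) t ω) (T : WithTop ℝ≥0)

/-- `V₁(t, x) = sup_u E[1_A(X_τ̄)]`. -/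
def V₁ (P : Measure Ω) (𝔽 𝔾 : Filtration ℝ≥0 mΩ)
    (W : ℝ≥0 → Ω → EuclideanSpace ℝ (Fin n))
    (f : EuclideanSpace ℝ (Fin n) → U → EuclideanSpace ℝ (Fin n))
    (σ : EuclideanSpace ℝ (Fin n) → U → Matrix (Fin n) (Fin n) ℝ)
    (A B : Set (EuclideanSpace ℝ (Fin n))) (T t : ℝ≥0) (x : EuclideanSpace ℝ (Fin n)) : ℝ :=
  ⨆ p : AdmissiblePair P 𝔽 𝔾 W f σ t x,
    ∫ ω, ind A (stoppedValue p.1.2 (exitTime A B T t p.1.2) ω) ∂P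

/-- `V₂(t, x) = sup_u E[sup_{s ∈ [t,T]} (1_A(X_s) ∧ inf_{r ∈ [t,s]} 1_{Bᶜ}(X_r))]`. -/
def V₂ (P : Measure Ω) (𝔽 𝔾 : Filtration ℝ≥0 mΩ)
    (W : ℝ≥0 → Ω → EuclideanSpace ℝ (Fin n))
    (f : EuclideanSpace ℝ (Fin n) → U → EuclideanSpace ℝ (Fin n))
    (σ : EuclideanSpace ℝ (Fin n) → U → Matrix (Fin n) (Fin n) ℝ)
    (A B : Set (EuclideanSpace ℝ (Fin n))) (T t : ℝ≥0) (x : EuclideanSpace ℝ (Fin n)) : ℝ :=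
  ⨆ p : AdmissiblePair P 𝔽 𝔾 W f σ t x,
    ∫ ω, (⨆ s : Icc t T, min (ind A (p.1.2 s ω)) (⨅ r : Icc t (s : ℝ≥0), ind Bᶜ (p.1.2 r ω))) ∂P

/-- `V₃(t, x) = sup_u sup_τ inf_ρ E[1_A(X_τ) ∧ 1_{Bᶜ}(X_ρ)]`, where `τ` runs over the
`𝔾`-stopping times with `t ≤ τ ≤ T` a.s. and `ρ` over those with `t ≤ ρ ≤ τ` a.s. -/
def V₃ (P : Measure Ω) (𝔽 𝔾 : Filtration ℝ≥0 mΩ)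
    (W : ℝ≥0 → Ω → EuclideanSpace ℝ (Fin n))
    (f : EuclideanSpace ℝ (Fin n) → U → EuclideanSpace ℝ (Fin n))
    (σ : EuclideanSpace ℝ (Fin n) → U → Matrix (Fin n) (Fin n) ℝ)
    (A B : Set (EuclideanSpace ℝ (Fin n))) (T t : ℝ≥0) (x : EuclideanSpace ℝ (Fin n)) : ℝ :=
  ⨆ p : AdmissiblePair P 𝔽 𝔾 W f σ t x,
    ⨆ τ : stoppingTimes P 𝔾 t (fun _ => (T : WithTop ℝ≥0)),
      ⨅ ρ : stoppingTimes P 𝔾 t τ.1,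
        ∫ ω, min (ind A (stoppedValue p.1.2 τ.1 ω)) (ind Bᶜ (stoppedValue p.1.2 ρ.1 ω)) ∂P

end Control

end ReachAvoid

end

namespace ReachAvoid

/-! ### Entry times of continuous adapted processes into closed sets -/

section HittingTime

variable {Ω E : Type*} {mΩ : MeasurableSpace Ω} {X : ℝ≥0 → Ω → E} {C : Set E}

/-! The values agree before the supremum over controls is taken, so one control and its path can be
fixed. Write `τ̄` for the exit time. As `A ∪ B` is closed, the path avoids it on `[t, τ̄)` and lies
in it at `τ̄` whenever `τ̄ < T`. If `X_τ̄ ∈ A`, disjointness shows that `B` is avoided on `[t, τ̄]`;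
otherwise any visit to `A` by time `T` comes after `τ̄`, when `B` has already been hit. Hence the
path functional equals `1_A(X_τ̄)` pathwise (`iSup_min_ind_eq_ind_stoppedValue`).

In the stopping game, choosing `τ = τ̄` secures this payoff against every `ρ`
(`min_ind_stoppedValue_exitTime`), while the reply `ρ = τ̄ ∧ τ` to any `τ` holds the payoff down to
it (`min_ind_stoppedValue_le`). Both choices are admissible because `τ̄` is a `𝔾`-stopping time. -/

theorem mem_of_hittingAfter_eq_coe [TopologicalSpace E] (hC : IsClosed C) {ω : Ω}
    (hX : Continuous fun s => X s ω) {t r : ℝ≥0} (h : hittingAfter X C t ω = r) : X r ω ∈ C := by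
  have hex : ∃ j, t ≤ j ∧ X j ω ∈ C := by
    by_contra! hne
    exact WithTop.coe_ne_top (h.symm.trans (hittingAfter_eq_top_iff.2 hne))
  have hcl : IsClosed {i : ℝ≥0 | t ≤ i ∧ X i ω ∈ C} := isClosed_Ici.inter (hC.preimage hX)
  rw [hittingAfter, if_pos hex, WithTop.coe_inj] at h
  exact h ▸ (hcl.csInf_mem hex (OrderBot.bddBelow _)).2

theorem hittingAfter_le_coe_iff [TopologicalSpace E] (hC : IsClosed C) {ω : Ω}
    (hX : Continuous fun s => X s ω) {t s : ℝ≥0} :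
    hittingAfter X C t ω ≤ s ↔ ∃ r ∈ Icc t s, X r ω ∈ C := by
  constructor
  · intro h
    obtain ⟨r, hr⟩ := WithTop.ne_top_iff_exists.1 (h.trans_lt (WithTop.coe_lt_top s)).ne
    rw [← hr, WithTop.coe_le_coe] at h
    exact ⟨r, ⟨WithTop.coe_le_coe.1 (hr ▸ le_hittingAfter ω), h⟩,
      mem_of_hittingAfter_eq_coe hC hX hr.symm⟩
  · rintro ⟨r, hr, hmem⟩
    exact (hittingAfter_le_of_mem hr.1 hmem).trans (WithTop.coe_le_coe.2 hr.2)

/-- The entry time of a continuous adapted process into a closed set is a stopping time. -/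
theorem isStoppingTime_hittingAfter_of_isClosed [PseudoEMetricSpace E] [MeasurableSpace E]
    [BorelSpace E] (hC : IsClosed C) {𝔾 : Filtration ℝ≥0 mΩ} (hXa : Adapted 𝔾 X)
    (hX : ∀ ω, Continuous fun s => X s ω) (t : ℝ≥0) :
    IsStoppingTime 𝔾 (hittingAfter X C t) := by
  intro s
  rcases lt_or_ge s t with hst | hts
  · have : {ω | hittingAfter X C t ω ≤ s} = ∅ := by
      ext ω
      exact iff_of_false (not_le.2 ((WithTop.coe_lt_coe.2 hst).trans_le (le_hittingAfter ω)))
        (notMem_empty ω)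
    rw [this]
    exact @MeasurableSet.empty _ (𝔾 s)
  have : Nonempty (Icc t s) := ⟨⟨t, le_rfl, hts⟩⟩
  -- By compactness, `C` is hit during `[t, s]` iff the distance to `C` has infimum zero there; by
  -- continuity a countable dense set of times suffices. All these times are at most `s`, so
  -- right-continuity of `𝔾` is not needed.
  have hset : {ω | hittingAfter X C t ω ≤ s} =
      {ω | ⨅ i, Metric.infEDist (X (TopologicalSpace.denseSeq (Icc t s) i) ω) C = 0} := by
    ext ω
    have hcont : Continuous fun r : Icc t s => Metric.infEDist (X r ω) C :=
      Metric.continuous_infEDist.comp ((hX ω).comp continuous_subtype_val)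
    simp only [mem_ofPred_eq]
    rw [hittingAfter_le_coe_iff hC (hX ω)]
    constructor
    · rintro ⟨r, hr, hmem⟩
      refine le_antisymm (le_of_forall_gt fun ε hε => ?_) zero_le
      obtain ⟨i, hi⟩ := (TopologicalSpace.denseRange_denseSeq (Icc t s)).exists_mem_open
        (isOpen_Iio.preimage hcont : IsOpen {r : Icc t s | Metric.infEDist (X r ω) C < ε})
        ⟨⟨r, hr⟩, by simpa [Metric.infEDist_zero_of_mem hmem] using hε⟩
      exact (iInf_le _ i).trans_lt hi
    · intro h
      obtain ⟨r, -, hr⟩ := isCompact_univ.exists_isMinOn univ_nonempty hcont.continuousOn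
      refine ⟨r, r.2, (Metric.mem_iff_infEDist_zero_of_closed hC).2 (le_antisymm ?_ zero_le)⟩
      exact h ▸ le_iInf fun i => hr (mem_univ _)
  rw [hset]
  have hmeas : Measurable[𝔾 s] fun ω => ⨅ i, Metric.infEDist (X (TopologicalSpace.denseSeq (Icc t s) i) ω) C :=
    Measurable.iInf fun i => measurable_infEDist.comp
      ((hXa (TopologicalSpace.denseSeq (Icc t s) i)).mono (𝔾.mono (TopologicalSpace.denseSeq (Icc t s) i).2.2) le_rfl)
  exact hmeas (measurableSet_singleton 0)

theorem measurable_stoppedValue_of_continuous [TopologicalSpace E]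
    [TopologicalSpace.PseudoMetrizableSpace E] [MeasurableSpace E] [BorelSpace E]
    {𝔾 : Filtration ℝ≥0 mΩ} (hXa : Adapted 𝔾 X) (hX : ∀ ω, Continuous fun s => X s ω)
    {τ : Ω → WithTop ℝ≥0} (hτ : IsStoppingTime 𝔾 τ) : Measurable (stoppedValue X τ) :=
  (measurable_uncurry_of_continuous_of_measurable hX
    fun s => (hXa s).mono (𝔾.le s) le_rfl).comp (hτ.measurable'.untopA.prodMk measurable_id)

end HittingTime

section Indicator

variable {n : ℕ} {S : Set (EuclideanSpace ℝ (Fin n))} {y : EuclideanSpace ℝ (Fin n)}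

theorem ind_of_mem (h : y ∈ S) : ind S y = 1 := indicator_of_mem h _

theorem ind_of_notMem (h : y ∉ S) : ind S y = 0 := indicator_of_notMem h _

theorem ind_nonneg (S : Set (EuclideanSpace ℝ (Fin n))) (y : EuclideanSpace ℝ (Fin n)) :
    0 ≤ ind S y :=
  indicator_nonneg (fun _ _ => zero_le_one) y

theorem ind_le_one (S : Set (EuclideanSpace ℝ (Fin n))) (y : EuclideanSpace ℝ (Fin n)) :
    ind S y ≤ 1 :=
  indicator_le_self' (fun _ _ => zero_le_one) y

theorem measurable_ind (hS : MeasurableSet S) : Measurable (ind S) :=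
  measurable_const.indicator hS

end Indicator

/-! ### Pathwise comparison at the exit time and the stopping game -/

section ExitTime

variable {Ω : Type*} {mΩ : MeasurableSpace Ω} {n : ℕ} {X : ℝ≥0 → Ω → EuclideanSpace ℝ (Fin n)}
  {A B : Set (EuclideanSpace ℝ (Fin n))} {T t : ℝ≥0}

/-- The last clause needs `r < T`: at `r = T` the truncation may be what stops the path, outside `A
∪ B`. -/
theorem exists_exitTime_eq_coe (hA : IsClosed A) (hB : IsClosed B) (ht : t ≤ T) {ω : Ω}
    (hX : Continuous fun s => X s ω) :
    ∃ r ∈ Icc t T, exitTime A B T t X ω = r ∧ (∀ s, t ≤ s → s < r → X s ω ∉ A ∪ B) ∧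
      (r < T → X r ω ∈ A ∪ B) := by
  have htop : exitTime A B T t X ω ≤ T := min_le_right _ _
  obtain ⟨r, hr⟩ := WithTop.ne_top_iff_exists.1 (htop.trans_lt (WithTop.coe_lt_top T)).ne
  have htr : (t : WithTop ℝ≥0) ≤ exitTime A B T t X ω :=
    le_min (le_hittingAfter ω) (WithTop.coe_le_coe.2 ht)
  rw [← hr, WithTop.coe_le_coe] at htop htr
  refine ⟨r, ⟨htr, htop⟩, hr.symm, fun s hts hsr => ?_, fun hrT => ?_⟩
  · refine notMem_of_lt_hittingAfter ((WithTop.coe_lt_coe.2 hsr).trans_le ?_) hts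
    exact hr.trans_le (min_le_left _ _)
  · refine mem_of_hittingAfter_eq_coe (hA.union hB) hX (t := t) ?_
    rcases min_choice (hittingAfter X (A ∪ B) t ω) (T : WithTop ℝ≥0) with h | h
    · exact (h.symm.trans hr.symm)
    · exact absurd (WithTop.coe_lt_coe.2 hrT) (hr.trans h).not_lt

theorem isStoppingTime_exitTime (hA : IsClosed A) (hB : IsClosed B) {𝔾 : Filtration ℝ≥0 mΩ}
    (hXa : Adapted 𝔾 X) (hX : ∀ ω, Continuous fun s => X s ω) :
    IsStoppingTime 𝔾 (exitTime A B T t X) :=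
  (isStoppingTime_hittingAfter_of_isClosed (hA.union hB) hXa hX t).min_const T

/-- The target `A` is reached before `B` up to time `T` if and only if the process is in `A` at
the exit time. -/
theorem iSup_min_ind_eq_ind_stoppedValue (hA : IsClosed A) (hB : IsClosed B)
    (hAB : Disjoint A B) (ht : t ≤ T) {ω : Ω} (hX : Continuous fun s => X s ω) :
    (⨆ s : Icc t T, min (ind A (X s ω)) (⨅ r : Icc t (s : ℝ≥0), ind Bᶜ (X r ω))) =
      ind A (stoppedValue X (exitTime A B T t X) ω) := by
  obtain ⟨r, hr, hexit, hlt, hmem⟩ := exists_exitTime_eq_coe hA hB ht hX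
  have hbdd (s : ℝ≥0) : BddBelow (range fun r : Icc t s => ind Bᶜ (X r ω)) :=
    ⟨0, forall_mem_range.2 fun _ => ind_nonneg _ _⟩
  have : Nonempty (Icc t T) := ⟨⟨r, hr⟩⟩
  simp only [stoppedValue, hexit, WithTop.untopD_coe, WithTop.untopA]
  by_cases hrA : X r ω ∈ A
  · rw [ind_of_mem hrA]
    refine le_antisymm (ciSup_le fun s => (min_le_left _ _).trans (ind_le_one _ _)) ?_
    refine le_ciSup_of_le
      ⟨1, forall_mem_range.2 fun s => (min_le_left _ _).trans (ind_le_one _ _)⟩ ⟨r, hr⟩ ?_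
    have : Nonempty (Icc t r) := ⟨⟨r, hr.1, le_rfl⟩⟩
    refine le_min (ind_of_mem hrA).ge (le_ciInf fun q => (ind_of_mem fun hqB => ?_).ge)
    obtain ⟨q, htq, hqr⟩ := q
    rcases (show q ≤ r from hqr).lt_or_eq with h | h
    · exact hlt q htq h (Or.inr hqB)
    · exact hAB.notMem_of_mem_left hrA (h ▸ hqB)
  · rw [ind_of_notMem hrA]
    refine le_antisymm (ciSup_le fun s => ?_) (Real.iSup_nonneg fun s =>
      le_min (ind_nonneg _ _) (Real.iInf_nonneg fun q => ind_nonneg _ _))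
    by_cases hsA : X s ω ∈ A
    · have hrs : r < s := by
        refine lt_of_le_of_ne (not_lt.1 fun h => hlt s s.2.1 h (Or.inl hsA)) ?_
        rintro h
        exact hrA (h ▸ hsA)
      have hrB : X r ω ∈ B := (hmem (hrs.trans_le s.2.2)).resolve_left hrA
      refine (min_le_right _ _).trans ((ciInf_le (hbdd s) ⟨r, hr.1, hrs.le⟩).trans ?_)
      exact (ind_of_notMem (notMem_compl_iff.2 hrB)).le
    · exact (min_le_left _ _).trans (ind_of_notMem hsA).le

theorem min_ind_stoppedValue_exitTime (hA : IsClosed A) (hB : IsClosed B) (hAB : Disjoint A B)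
    (ht : t ≤ T) {ω : Ω} (hX : Continuous fun s => X s ω) {ρ : Ω → WithTop ℝ≥0}
    (htρ : (t : WithTop ℝ≥0) ≤ ρ ω) (hρ : ρ ω ≤ exitTime A B T t X ω) :
    min (ind A (stoppedValue X (exitTime A B T t X) ω)) (ind Bᶜ (stoppedValue X ρ ω)) =
      ind A (stoppedValue X (exitTime A B T t X) ω) := by
  obtain ⟨r, hr, hexit, hlt, -⟩ := exists_exitTime_eq_coe hA hB ht hX
  rw [hexit] at hρ
  obtain ⟨q, hq⟩ := WithTop.ne_top_iff_exists.1 (hρ.trans_lt (WithTop.coe_lt_top r)).ne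
  rw [← hq, WithTop.coe_le_coe] at htρ hρ
  simp only [stoppedValue, hexit, ← hq, WithTop.untopD_coe, WithTop.untopA]
  by_cases hrA : X r ω ∈ A
  · refine min_eq_left ((ind_le_one _ _).trans (ind_of_mem fun hqB => ?_).ge)
    rcases hρ.lt_or_eq with h | h
    · exact hlt q htρ h (Or.inr hqB)
    · exact hAB.notMem_of_mem_left hrA (h ▸ hqB)
  · rw [ind_of_notMem hrA]
    exact min_eq_left (ind_nonneg _ _)

/-- A positive payoff requires `X_τ ∈ A`, hence `τ̄ ≤ τ` and the reply is `τ̄` itself. If the path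
is in `B` there, the payoff is zero; otherwise it is in `A`. -/
theorem min_ind_stoppedValue_le (hA : IsClosed A) (hB : IsClosed B) (ht : t ≤ T) {ω : Ω}
    (hX : Continuous fun s => X s ω) {τ : Ω → WithTop ℝ≥0} (htτ : (t : WithTop ℝ≥0) ≤ τ ω)
    (hτT : τ ω ≤ T) :
    min (ind A (stoppedValue X τ ω))
        (ind Bᶜ (stoppedValue X (fun ω => min (exitTime A B T t X ω) (τ ω)) ω)) ≤
      ind A (stoppedValue X (exitTime A B T t X) ω) := by
  obtain ⟨r, hr, hexit, hlt, hmem⟩ := exists_exitTime_eq_coe hA hB ht hX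
  obtain ⟨q, hq⟩ := WithTop.ne_top_iff_exists.1 (hτT.trans_lt (WithTop.coe_lt_top T)).ne
  rw [← hq, WithTop.coe_le_coe] at htτ hτT
  simp only [stoppedValue, hexit, ← hq, ← WithTop.coe_min, WithTop.untopD_coe, WithTop.untopA]
  by_cases hqA : X q ω ∈ A
  · have hrq : r ≤ q := not_lt.1 fun h => hlt q htτ h (Or.inl hqA)
    rw [min_eq_left hrq]
    by_cases hrB : X r ω ∈ B
    · exact (min_le_right _ _).trans
        ((ind_of_notMem (notMem_compl_iff.2 hrB)).trans_le (ind_nonneg _ _))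
    · have hrA : X r ω ∈ A := by
        rcases hrq.lt_or_eq with h | h
        · exact (hmem (h.trans_le hτT)).resolve_right hrB
        -- Here `τ̄ = τ`, possibly both equal to `T`, so membership comes from `X_τ ∈ A`.
        · exact h ▸ hqA
      exact (min_le_left _ _).trans ((ind_le_one _ _).trans (ind_of_mem hrA).ge)
  · exact (min_le_left _ _).trans ((ind_of_notMem hqA).trans_le (ind_nonneg _ _))

/-- For a fixed continuous adapted process, the stopping game has the value `P(X_τ̄ ∈ A)`. -/
theorem iSup_iInf_integral_eq (P : Measure Ω) [IsProbabilityMeasure P] (hA : IsClosed A)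
    (hB : IsClosed B) (hAB : Disjoint A B) (ht : t ≤ T) {𝔾 : Filtration ℝ≥0 mΩ}
    (hXa : Adapted 𝔾 X) (hX : ∀ ω, Continuous fun s => X s ω) :
    (⨆ τ : stoppingTimes P 𝔾 t (fun _ => (T : WithTop ℝ≥0)), ⨅ ρ : stoppingTimes P 𝔾 t τ.1,
        ∫ ω, min (ind A (stoppedValue X τ.1 ω)) (ind Bᶜ (stoppedValue X ρ.1 ω)) ∂P) =
      ∫ ω, ind A (stoppedValue X (exitTime A B T t X) ω) ∂P := by
  have hstopping : IsStoppingTime 𝔾 (exitTime A B T t X) := isStoppingTime_exitTime hA hB hXa hX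
  have hle_exit (ω : Ω) : (t : WithTop ℝ≥0) ≤ exitTime A B T t X ω :=
    le_min (le_hittingAfter ω) (WithTop.coe_le_coe.2 ht)
  have hint : Integrable (fun ω => ind A (stoppedValue X (exitTime A B T t X) ω)) P := by
    refine Integrable.of_bound ((measurable_ind hA.measurableSet).comp
      (measurable_stoppedValue_of_continuous hXa hX hstopping)).aestronglyMeasurable 1
      (ae_of_all _ fun ω => ?_)
    rw [Real.norm_of_nonneg (ind_nonneg _ _)]
    exact ind_le_one _ _
  have hnonneg (τ ρ : Ω → WithTop ℝ≥0) (ω : Ω) :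
      0 ≤ min (ind A (stoppedValue X τ ω)) (ind Bᶜ (stoppedValue X ρ ω)) :=
    le_min (ind_nonneg _ _) (ind_nonneg _ _)
  have hupper (τ : stoppingTimes P 𝔾 t (fun _ => (T : WithTop ℝ≥0))) :
      ⨅ ρ : stoppingTimes P 𝔾 t τ.1,
        ∫ ω, min (ind A (stoppedValue X τ.1 ω)) (ind Bᶜ (stoppedValue X ρ.1 ω)) ∂P ≤
      ∫ ω, ind A (stoppedValue X (exitTime A B T t X) ω) ∂P := by
    have hρ : (fun ω => min (exitTime A B T t X ω) (τ.1 ω)) ∈ stoppingTimes P 𝔾 t τ.1 :=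
      ⟨hstopping.min τ.2.1, τ.2.2.mono fun ω h => ⟨le_min (hle_exit ω) h.1, min_le_right _ _⟩⟩
    refine (ciInf_le ⟨0, forall_mem_range.2 fun ρ => integral_nonneg (hnonneg _ _)⟩
      ⟨_, hρ⟩).trans ?_
    -- Only the upper bound has to be integrable; measurability of the payoff is not required.
    exact integral_mono_of_nonneg (ae_of_all _ (hnonneg _ _)) hint
      (τ.2.2.mono fun ω h => min_ind_stoppedValue_le hA hB ht (hX ω) h.1 h.2)
  have hexit : exitTime A B T t X ∈ stoppingTimes P 𝔾 t (fun _ => (T : WithTop ℝ≥0)) :=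
    ⟨hstopping, ae_of_all _ fun ω => ⟨hle_exit ω, min_le_right _ _⟩⟩
  have : Nonempty (stoppingTimes P 𝔾 t (fun _ => (T : WithTop ℝ≥0))) := ⟨⟨_, hexit⟩⟩
  refine le_antisymm (ciSup_le hupper)
    (le_ciSup_of_le ⟨_, forall_mem_range.2 hupper⟩ ⟨_, hexit⟩ ?_)
  -- A real infimum over an empty family would be `0`; the reply `ρ = τ̄` excludes this.
  have : Nonempty (stoppingTimes P 𝔾 t (exitTime A B T t X)) :=
    ⟨⟨_, hstopping, ae_of_all _ fun ω => ⟨hle_exit ω, le_rfl⟩⟩⟩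
  refine le_ciInf fun ρ => (integral_congr_ae (ρ.2.2.mono fun ω h => ?_)).ge
  exact min_ind_stoppedValue_exitTime hA hB hAB ht (hX ω) h.1 h.2

end ExitTime

section Value

variable {Ω : Type*} {mΩ : MeasurableSpace Ω} {n m : ℕ} {U : Set (EuclideanSpace ℝ (Fin m))}

/-- The three values of the reach-avoid problem agree for every information filtration. -/
theorem values_eq (P : Measure Ω) [IsProbabilityMeasure P] (𝔽 𝔾 : Filtration ℝ≥0 mΩ)
    (W : ℝ≥0 → Ω → EuclideanSpace ℝ (Fin n))
    (f : EuclideanSpace ℝ (Fin n) → U → EuclideanSpace ℝ (Fin n))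
    (σ : EuclideanSpace ℝ (Fin n) → U → Matrix (Fin n) (Fin n) ℝ)
    {A B : Set (EuclideanSpace ℝ (Fin n))} (hA : IsClosed A) (hB : IsClosed B)
    (hAB : Disjoint A B) {T t : ℝ≥0} (ht : t ≤ T) (x : EuclideanSpace ℝ (Fin n)) :
    V₁ P 𝔽 𝔾 W f σ A B T t x = V₂ P 𝔽 𝔾 W f σ A B T t x ∧
      V₂ P 𝔽 𝔾 W f σ A B T t x = V₃ P 𝔽 𝔾 W f σ A B T t x := by
  have h₁₂ : V₁ P 𝔽 𝔾 W f σ A B T t x = V₂ P 𝔽 𝔾 W f σ A B T t x :=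
    iSup_congr fun p => integral_congr_ae <| ae_of_all _ fun ω =>
      (iSup_min_ind_eq_ind_stoppedValue hA hB hAB ht (p.2.continuous ω)).symm
  have h₁₃ : V₁ P 𝔽 𝔾 W f σ A B T t x = V₃ P 𝔽 𝔾 W f σ A B T t x :=
    iSup_congr fun p =>
      (iSup_iInf_integral_eq P hA hB hAB ht p.2.adapted p.2.continuous).symm
  exact ⟨h₁₂, h₁₂.symm.trans h₁₃⟩

end Value

end ReachAvoid

/-- Equality of the exit-time value, the path-functional value and the stopping-game value of the
reach-avoid problem, both when controls and stopping times refer to the Brownian filtration `𝔽`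
and when they refer to the filtration `𝔽_t` of the increments after `t`. -/
theorem mainTheorem8 {Ω : Type*} [MeasurableSpace Ω] (P : Measure Ω) [IsProbabilityMeasure P]
    [P.IsComplete] {n m : ℕ}
    (W : ℝ≥0 → Ω → EuclideanSpace ℝ (Fin n)) (hWm : ∀ s, Measurable (W s))
    (hW : ReachAvoid.IsBrownianMotion W P)
    (U : Set (EuclideanSpace ℝ (Fin m))) (hU : IsCompact U)
    (f : EuclideanSpace ℝ (Fin n) → U → EuclideanSpace ℝ (Fin n))
    (hf : Continuous fun p : EuclideanSpace ℝ (Fin n) × U => f p.1 p.2)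
    (hfLip : ∃ K : ℝ, ∀ (v : U) (x y : EuclideanSpace ℝ (Fin n)), ‖f x v - f y v‖ ≤ K * ‖x - y‖)
    (σ : EuclideanSpace ℝ (Fin n) → U → Matrix (Fin n) (Fin n) ℝ)
    (hσ : Continuous fun p : EuclideanSpace ℝ (Fin n) × U => σ p.1 p.2)
    (hσLip : ∃ K : ℝ, ∀ (v : U) (x y : EuclideanSpace ℝ (Fin n)),
      Real.sqrt (ReachAvoid.frobSq (σ x v - σ y v)) ≤ K * ‖x - y‖)
    (A B : Set (EuclideanSpace ℝ (Fin n))) (hA : IsClosed A) (hB : IsClosed B)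
    (hAB : Disjoint A B) (T t : ℝ≥0) (ht : t ≤ T) (x : EuclideanSpace ℝ (Fin n)) :
    (ReachAvoid.V₁ P (ReachAvoid.brownianFiltration P W hWm)
        (ReachAvoid.brownianFiltration P W hWm) W f σ A B T t x =
      ReachAvoid.V₂ P (ReachAvoid.brownianFiltration P W hWm)
        (ReachAvoid.brownianFiltration P W hWm) W f σ A B T t x ∧
    ReachAvoid.V₂ P (ReachAvoid.brownianFiltration P W hWm)
        (ReachAvoid.brownianFiltration P W hWm) W f σ A B T t x =
      ReachAvoid.V₃ P (ReachAvoid.brownianFiltration P W hWm)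
        (ReachAvoid.brownianFiltration P W hWm) W f σ A B T t x) ∧
    (ReachAvoid.V₁ P (ReachAvoid.brownianFiltration P W hWm)
        (ReachAvoid.shiftedFiltration P W hWm t) W f σ A B T t x =
      ReachAvoid.V₂ P (ReachAvoid.brownianFiltration P W hWm)
        (ReachAvoid.shiftedFiltration P W hWm t) W f σ A B T t x ∧
    ReachAvoid.V₂ P (ReachAvoid.brownianFiltration P W hWm)
        (ReachAvoid.shiftedFiltration P W hWm t) W f σ A B T t x =
      ReachAvoid.V₃ P (ReachAvoid.brownianFiltration P W hWm)
        (ReachAvoid.shiftedFiltration P W hWm t) W f σ A B T t x) := by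
  exact ⟨ReachAvoid.values_eq P _ _ W f σ hA hB hAB ht x,
    ReachAvoid.values_eq P _ _ W f σ hA hB hAB ht x⟩
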